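/- For $n\ge 0$ let $\mathcal B_n$ be the set of type $B$ permutations of order $n$, i.e. of the permutations $\sigma$ of $\{-n,\ldots,-1,0,1,\ldots,n\}$ with $\sigma(-i)=-\sigma(i)$ for all $i$, and identify $\sigma$ with the sequence $(0,\sigma_1,\ldots,\sigma_n)$, where $\sigma_i=\sigma(i)$ and $\sigma_0=0$. For $0\le j,k\le n$ let $B(n,k,j)$ be the number of $\sigma\in\mathcal B_n$ such that $(0,\sigma_1,\ldots,\sigma_n)$ has exactly $k$ descents (indices $1\le i\le n$ with $\sigma_{i-1}>\sigma_i$) and exactly $j$ negative entries. Put $b(n,k,j)=B(n,k,j)/\binom{n}{j}$, $$p_{n,j}(x)=\sum_{k=0}^{n}b(n,k,j)x^k,\qquad P_{n,j}(x)=\sum_{k=0}^{n}B(n,k,j)x^k .$$ A polynomial in $\mathbb R[x]$ is called real-rooted if all its complex roots are real. For real-rooted $f,g\in\mathbb R[x]$ with positive leading coefficients, write $f\ll g$ if their roots $\alpha_1\ge\alpha_2\ge\cdots\ge\alpha_m$ and $\beta_1\ge\beta_2\ge\cdots\ge\beta_l$, listed with multiplicity, satisfy $l\in\{m,m+1\}$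 and alternate: $\cdots\le\alpha_2\le\beta_2\le\alpha_1\le\beta_1$. A sequence $(f_j)_{j=0}^{n}$ of real-rooted polynomials with positive leading coefficients is called interlacing if $f_i\ll f_j$ whenever $0\le i<j\le n$. **Theorem.** For every $n\ge1$ the sequence $(p_{n,j})_{j=0}^{n}$ is interlacing. Consequently, for all real $c_0,c_1,\ldots,c_n\ge0$, not all zero, the polynomial $c_0p_{n,0}(x)+c_1p_{n,1}(x)+\cdots+c_np_{n,n}(x)$ has only real roots. Moreover $P_{n,j}=\binom nj p_{n,j}$ for $0\le j\le n$, and the same statement (interlacing, and real-rootedness of every linear combination with nonnegative coefficients that are not all zero) holds for the sequence $(P_{n,j})_{j=0}^{n}$. -/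

import Mathlib

open Polynomial

namespace SignedDescents

/-- The set `{-n, …, -1, 0, 1, …, n}`. -/
abbrev Letters (n : ℕ) : Type := Finset.Icc (-(n : ℤ)) (n : ℤ)

/-- Type `B` permutations of order `n`: the odd permutations of `{-n, …, n}`. -/
noncomputable def signedPerms (n : ℕ) : Finset (Equiv.Perm (Letters n)) :=
  Finset.univ.filter fun σ =>
    ∀ i j : Letters n, (j : ℤ) = -(i : ℤ) → (σ j : ℤ) = -(σ i : ℤ)

/-- The sequence `(σ 0, σ 1, …, σ n)`; the entry `σ 0` is `0` when `σ` is odd. -/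
def word {n : ℕ} (σ : Equiv.Perm (Letters n)) (i : Fin (n + 1)) : ℤ :=
  (σ ⟨(i : ℤ), Finset.mem_Icc.mpr ⟨by omega, by omega⟩⟩ : ℤ)

/-- The number of descents of a sequence `(a 0, …, a s)`. -/
def des {s : ℕ} (a : Fin (s + 1) → ℤ) : ℕ :=
  (Finset.univ.filter fun i : Fin s => a i.castSucc > a i.succ).card

/-- The number of negative entries of a sequence `(a 0, …, a s)`. -/
def neg {s : ℕ} (a : Fin (s + 1) → ℤ) : ℕ :=
  (Finset.univ.filter fun i : Fin (s + 1) => a i < 0).card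

/-- `B(n,k,j)`: the number of type `B` permutations of order `n` with `k` descents and
`j` minus signs. -/
noncomputable def B (n k j : ℕ) : ℕ :=
  ((signedPerms n).filter fun σ => des (word σ) = k ∧ neg (word σ) = j).card

/-- `b(n,k,j) = B(n,k,j) / C(n,j)`, an exact division of real numbers (used for `j ≤ n`). -/
noncomputable def b (n k j : ℕ) : ℝ := (B n k j : ℝ) / (n.choose j : ℝ)

/-- `P_{n,j}(x) = ∑_{k=0}^n B(n,k,j) x^k`. -/
noncomputable def bigP (n j : ℕ) : ℝ[X] :=
  ∑ k ∈ Finset.range (n + 1), C (B n k j : ℝ) * X ^ k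

/-- `p_{n,j}(x) = ∑_{k=0}^n b(n,k,j) x^k`. -/
noncomputable def smallP (n j : ℕ) : ℝ[X] :=
  ∑ k ∈ Finset.range (n + 1), C (b n k j) * X ^ k

/-- All complex roots of `f` are real (so nonzero constants qualify, and `0` does not). -/
def RealRooted (f : ℝ[X]) : Prop := ∀ z : ℂ, aeval z f = 0 → z.im = 0

/-- The roots of `f` with multiplicity, in decreasing order. -/
noncomputable def rootList (f : ℝ[X]) : List ℝ := f.roots.sort (· ≥ ·)

/-- `f ≪ g`: both polynomials are real-rooted with positive leading coefficients, and their roots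
`α₁ ≥ α₂ ≥ ⋯ ≥ α_m` and `β₁ ≥ β₂ ≥ ⋯ ≥ β_l`, listed with multiplicity, alternate:
`⋯ ≤ α₂ ≤ β₂ ≤ α₁ ≤ β₁`. The alternation forces `l = m` or `l = m + 1`. -/
def Interleaves (f g : ℝ[X]) : Prop :=
  (RealRooted f ∧ 0 < f.leadingCoeff) ∧ (RealRooted g ∧ 0 < g.leadingCoeff) ∧
  ((rootList g).length = (rootList f).length ∨
    (rootList g).length = (rootList f).length + 1) ∧
  (∀ (i : ℕ) (hf : i < (rootList f).length) (hg : i < (rootList g).length),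
    (rootList f)[i] ≤ (rootList g)[i]) ∧
  (∀ (i : ℕ) (hf : i < (rootList f).length) (hg : i + 1 < (rootList g).length),
    (rootList g)[i + 1] ≤ (rootList f)[i])

/-- The finite sequence `f 0, …, f n` is interlacing. -/
def Interlacing {n : ℕ} (f : Fin (n + 1) → ℝ[X]) : Prop :=
  (∀ i, RealRooted (f i) ∧ 0 < (f i).leadingCoeff) ∧
  ∀ i j, i < j → Interleaves (f i) (f j)

end SignedDescents

namespace SignedDescents

/-! Fix the set `S` of absolute values carrying a minus sign, `|S| = j`. The words with negative set
`S` are the arrangements, after a leading `0`, of `n` distinct integers of which exactly `j` lie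
below `0`. Descents depend only on relative order, so all `C(n,j)` choices of `S` give the same
polynomial, `firstLetterPoly n j`; this is `p_{n,j}`. Deleting the first letter and recording the
rank `i` of the next one gives p_{n+1,j} = x ∑_{i<j} p_{n,i} + ∑_{i≥j} p_{n,i}.

For `z` in the open upper half-plane, induction on `n` shows that the values p_{n,j}(z) are nonzero
and that, for i ≤ j, the angle from p_{n,i}(z) to p_{n,j}(z) lies in [0, arg z]. `InSector.step`
carries the relation through the recursion. The sector has angle less than π, so nonnegative nonzero
combinations of its nonzero vectors do not vanish; this gives both the nonvanishing in the induction
and the real-rootedness of combinations.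

Interlacing follows by Hermite–Biehler: Im(g/f) ≥ 0 on the upper half-plane confines a continuous
argument of g/f to [0, π], and its boundary value at a real `t` is π times the difference of the
numbers of roots beyond `t`. -/

/-! ### Sectors in the complex plane. -/

/-- `b` lies in the closed sector spanned by `a` and `z * a` (for `z` in the upper half-plane). -/
def InSector (z a b : ℂ) : Prop :=
  0 ≤ b.im * a.re - b.re * a.im ∧ 0 ≤ (z * a).im * b.re - (z * a).re * b.im

lemma InSector.sum_right {ι : Type*} {z a : ℂ} {s : Finset ι} {v : ι → ℂ}
    (h : ∀ i ∈ s, InSector z a (v i)) : InSector z a (∑ i ∈ s, v i) := by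
  constructor
  · rw [Complex.im_sum, Complex.re_sum, Finset.sum_mul, Finset.sum_mul, ← Finset.sum_sub_distrib]
    exact Finset.sum_nonneg fun i hi => (h i hi).1
  · rw [Complex.im_sum, Complex.re_sum, Finset.mul_sum, Finset.mul_sum, ← Finset.sum_sub_distrib]
    exact Finset.sum_nonneg fun i hi => (h i hi).2

lemma InSector.sum_left {ι : Type*} {z b : ℂ} {s : Finset ι} {v : ι → ℂ}
    (h : ∀ i ∈ s, InSector z (v i) b) : InSector z (∑ i ∈ s, v i) b := by
  constructor
  · rw [Complex.im_sum, Complex.re_sum, Finset.mul_sum, Finset.mul_sum, ← Finset.sum_sub_distrib]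
    exact Finset.sum_nonneg fun i hi => (h i hi).1
  · rw [Finset.mul_sum, Complex.im_sum, Complex.re_sum, Finset.sum_mul, Finset.sum_mul,
      ← Finset.sum_sub_distrib]
    exact Finset.sum_nonneg fun i hi => (h i hi).2

lemma InSector.refl {z : ℂ} (hz : 0 < z.im) (a : ℂ) : InSector z a a := by
  refine ⟨by linarith [mul_comm a.im a.re], ?_⟩
  have : (z * a).im * a.re - (z * a).re * a.im = z.im * (a.re ^ 2 + a.im ^ 2) := by
    simp only [Complex.mul_im, Complex.mul_re]; ring
  rw [this]; positivity

lemma InSector.smul {z a b : ℂ} (h : InSector z a b) {c d : ℝ} (hc : 0 ≤ c) (hd : 0 ≤ d) :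
    InSector z (c * a) (d * b) := by
  have hcd := mul_nonneg hc hd
  refine ⟨?_, ?_⟩
  · refine (mul_nonneg hcd h.1).trans_eq ?_
    simp; ring
  · refine (mul_nonneg hcd h.2).trans_eq ?_
    simp; ring

/-- Rotating `a` by `z` reverses the sector relation. -/
lemma InSector.mul_left {z a b : ℂ} (h : InSector z a b) : InSector z b (z * a) := by
  refine ⟨h.2, ?_⟩
  refine (mul_nonneg (add_nonneg (sq_nonneg z.re) (sq_nonneg z.im)) h.1).trans_eq ?_
  simp only [Complex.mul_im, Complex.mul_re]; ring

/-- The two forms cannot vanish together: `b` would be parallel to both `a` and `z * a`, which are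
independent over ℝ. Their sum is thus a real linear functional of `b`, strictly positive on the
nonzero vectors of the sector. -/
lemma InSector.pos {z a b : ℂ} (hz : 0 < z.im) (ha : a ≠ 0) (hb : b ≠ 0) (h : InSector z a b) :
    0 < (b.im * a.re - b.re * a.im) + ((z * a).im * b.re - (z * a).re * b.im) := by
  refine lt_of_le_of_ne (add_nonneg h.1 h.2) fun h0 => ?_
  have h1 : b.im * a.re - b.re * a.im = 0 := by linarith [h.1, h.2]
  have h2 : (z * a).im * b.re - (z * a).re * b.im = 0 := by linarith [h.1, h.2]
  have h3 : z.im * (a.re * b.re + a.im * b.im) = 0 := by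
    simp only [Complex.mul_im, Complex.mul_re] at h2
    linear_combination h2 + z.re * h1
  have h4 : a.re * b.re + a.im * b.im = 0 := (mul_eq_zero.1 h3).resolve_left hz.ne'
  -- Lagrange's identity: |a|²|b|² is the square of the dot product plus the square of the cross
  -- product.
  have h5 : Complex.normSq a * Complex.normSq b = 0 := by
    simp only [Complex.normSq_apply]
    linear_combination (a.re * b.re + a.im * b.im) * h4 + (b.im * a.re - b.re * a.im) * h1
  rcases mul_eq_zero.1 h5 with h6 | h6
  · exact ha (Complex.normSq_eq_zero.1 h6)
  · exact hb (Complex.normSq_eq_zero.1 h6)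

/-- A nonnegative nonzero combination of nonzero vectors of a sector is nonzero. -/
lemma InSector.sum_ne_zero {ι : Type*} {z a : ℂ} (hz : 0 < z.im) (ha : a ≠ 0) {s : Finset ι}
    {v : ι → ℂ} (h : ∀ i ∈ s, InSector z a (v i)) (hv : ∀ i ∈ s, v i ≠ 0) {c : ι → ℝ}
    (hc : ∀ i ∈ s, 0 ≤ c i) (hc' : ∃ i ∈ s, c i ≠ 0) : ∑ i ∈ s, (c i : ℂ) * v i ≠ 0 := by
  obtain ⟨i₀, hi₀, hci₀⟩ := hc'
  let L : ℂ → ℝ := fun b =>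
    (b.im * a.re - b.re * a.im) + ((z * a).im * b.re - (z * a).re * b.im)
  have hL : L (∑ i ∈ s, (c i : ℂ) * v i) = ∑ i ∈ s, c i * L (v i) := by
    simp only [L, Complex.im_sum, Complex.re_sum, Finset.sum_mul, Finset.mul_sum,
      ← Finset.sum_sub_distrib, ← Finset.sum_add_distrib]
    refine Finset.sum_congr rfl fun i _ => ?_
    simp; ring
  have hpos : 0 < L (∑ i ∈ s, (c i : ℂ) * v i) := by
    rw [hL]
    have hp : ∀ i ∈ s, 0 < L (v i) := fun i hi => (h i hi).pos hz ha (hv i hi)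
    refine Finset.sum_pos' (fun i hi => mul_nonneg (hc i hi) (hp i hi).le)
      ⟨i₀, hi₀, mul_pos (lt_of_le_of_ne (hc i₀ hi₀) (Ne.symm hci₀)) (hp i₀ hi₀)⟩
  intro h0
  rw [h0] at hpos
  simp [L] at hpos

/-- With `A`, `B`, `C` the sums of the values over i < j, j ≤ i < k and i ≥ k, the two vectors are
the recursion at `j` and at `k`. Put [u, v] = Im(v ū). Then [zA + B + C, zA + zB + C] = [B, zA] +
|z|²[A, B] + Im z |B|² + [C, zB] + [B, C]: the terms pairing `A` with `C` cancel, so no relation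
between them is needed. The second form expands similarly, with Im z |zA + C|² absorbing those
terms. -/
lemma InSector.step {z A B C : ℂ} (hz : 0 < z.im) (hAB : InSector z A B)
    (hBC : InSector z B C) : InSector z (z * A + B + C) (z * A + z * B + C) := by
  have hN : 0 ≤ z.re ^ 2 + z.im ^ 2 := by positivity
  have hB := mul_nonneg hz.le (Complex.normSq_nonneg B)
  have hAC' := mul_nonneg hz.le (Complex.normSq_nonneg (z * A + C))
  have h1 := mul_nonneg hN hAB.1
  have h2 := mul_nonneg hN hAB.2
  have h3 := mul_nonneg hN hBC.1
  refine ⟨?_, ?_⟩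
  · refine (add_nonneg (add_nonneg (add_nonneg (add_nonneg hAB.2 h1) hB) hBC.2) hBC.1).trans_eq ?_
    simp only [Complex.normSq_apply, Complex.add_re, Complex.add_im, Complex.mul_im,
      Complex.mul_re]
    ring
  · refine (add_nonneg (add_nonneg (add_nonneg (add_nonneg hAC' h1) h2) hBC.2) h3).trans_eq ?_
    simp only [Complex.normSq_apply, Complex.add_re, Complex.add_im, Complex.mul_im,
      Complex.mul_re]
    ring

/-! ### The recursion and its sector property. -/

/-- The generating polynomial by descents of the permutations of `n + 1` letters whose first
letter exceeds exactly `j` other letters. -/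
noncomputable def firstLetterPoly : ℕ → ℕ → ℝ[X]
  | 0, _ => 1
  | n + 1, j => ∑ i ∈ Finset.range (n + 1), (if i < j then X else 1) * firstLetterPoly n i

lemma aeval_firstLetterPoly_succ (z : ℂ) (n j : ℕ) (hj : j ≤ n + 1) :
    aeval z (firstLetterPoly (n + 1) j) =
      z * ∑ i ∈ Finset.Ico 0 j, aeval z (firstLetterPoly n i) +
        ∑ i ∈ Finset.Ico j (n + 1), aeval z (firstLetterPoly n i) := by
  rw [firstLetterPoly, map_sum, Finset.range_eq_Ico,
    ← Finset.sum_Ico_consecutive _ (Nat.zero_le j) hj, Finset.mul_sum]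
  congr 1 <;> refine Finset.sum_congr rfl fun i hi => ?_
  · simp [(Finset.mem_Ico.1 hi).2]
  · simp [not_lt.2 (Finset.mem_Ico.1 hi).1]

lemma firstLetterPoly_inSector {z : ℂ} (hz : 0 < z.im) (n : ℕ) :
    (∀ i j, i ≤ j → j ≤ n →
      InSector z (aeval z (firstLetterPoly n i)) (aeval z (firstLetterPoly n j))) ∧
    ∀ j ≤ n, aeval z (firstLetterPoly n j) ≠ 0 := by
  have hz0 : z ≠ 0 := by rintro rfl; simp at hz
  induction n with
  | zero => exact ⟨fun i j _ _ => by simpa [firstLetterPoly] using InSector.refl hz 1,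
      fun j _ => by simp [firstLetterPoly]⟩
  | succ n ih =>
    obtain ⟨ih1, ih2⟩ := ih
    set v : ℕ → ℂ := fun i => aeval z (firstLetterPoly n i) with hv
    have hR : ∀ a b c d, b ≤ c → d ≤ n + 1 →
        InSector z (∑ i ∈ Finset.Ico a b, v i) (∑ i ∈ Finset.Ico c d, v i) := by
      intro a b c d hbc hd
      refine InSector.sum_left fun i hi => InSector.sum_right fun j hj => ?_
      rw [Finset.mem_Ico] at hi hj
      exact ih1 i j (by omega) (by omega)
    refine ⟨fun j k hjk hk => ?_, fun j hj => ?_⟩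
    · rw [aeval_firstLetterPoly_succ z n j (by omega), aeval_firstLetterPoly_succ z n k hk,
        ← Finset.sum_Ico_consecutive _ (Nat.zero_le j) hjk,
        ← Finset.sum_Ico_consecutive _ hjk hk, mul_add, ← add_assoc]
      exact InSector.step hz (hR _ _ _ _ le_rfl (by omega)) (hR _ _ _ _ le_rfl le_rfl)
    -- All summands lie in the sector from `v j` to `z * v j`: `v i` for i ≥ j directly, `z * v i`
    -- for i < j by rotation. The minimum covers j = n + 1, where `v n` serves as base.
    · have key := InSector.sum_ne_zero (z := z) (a := v (min j n)) hz (ih2 _ (by simp))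
        (s := Finset.range (n + 1)) (v := fun i => (if i < j then z else 1) * v i)
        (c := fun _ => 1) ?_ ?_ (fun _ _ => zero_le_one) ⟨0, by simp, one_ne_zero⟩
      · convert key using 1
        rw [firstLetterPoly, map_sum]
        refine Finset.sum_congr rfl fun i _ => ?_
        split_ifs <;> simp [hv]
      · intro i hi
        rw [Finset.mem_range] at hi
        split_ifs with h
        · exact (ih1 i (min j n) (by omega) (by omega)).mul_left
        · rw [one_mul]
          exact ih1 _ _ (by omega) (by omega)
      · intro i hi
        rw [Finset.mem_range] at hi
        refine mul_ne_zero ?_ (ih2 i (by omega))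
        split_ifs
        exacts [hz0, one_ne_zero]

/-! ### Hermite–Biehler by counting arguments. -/

open Filter Topology

/-- The sum of the arguments of `z - α` over the elements `α` of a multiset of real numbers. -/
noncomputable def argSum (s : Multiset ℝ) (z : ℂ) : ℝ :=
  (s.map fun α : ℝ => (z - α).arg).sum

lemma continuousOn_argSum (s : Multiset ℝ) : ContinuousOn (argSum s) {z | 0 < z.im} := by
  induction s using Multiset.induction with
  | empty =>
    have : argSum 0 = fun _ => 0 := by funext z; simp [argSum]
    rw [this]
    exact continuousOn_const
  | cons α s ih =>
    have : argSum (α ::ₘ s) = fun z : ℂ => (z - α).arg + argSum s z := by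
      funext z; simp [argSum]
    rw [this]
    refine ContinuousOn.add (fun z hz => ?_) ih
    refine ContinuousAt.continuousWithinAt ?_
    refine ContinuousAt.comp (f := fun z : ℂ => z - α) (g := Complex.arg)
      (Complex.continuousAt_arg ?_) (by fun_prop)
    right
    simpa using (ne_of_gt hz : z.im ≠ 0)

lemma exists_pos_prod_eq_exp_argSum (s : Multiset ℝ) {z : ℂ} (hz : 0 < z.im) :
    ∃ r : ℝ, 0 < r ∧
      (s.map fun α : ℝ => z - (α : ℂ)).prod = r * Complex.exp (argSum s z * Complex.I) := by
  induction s using Multiset.induction with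
  | empty => exact ⟨1, one_pos, by simp [argSum]⟩
  | cons α s ih =>
    obtain ⟨r, hr, h⟩ := ih
    have h0 : z - (α : ℂ) ≠ 0 := by
      intro h0
      have := congrArg Complex.im h0
      simp at this
      exact hz.ne' this
    refine ⟨‖z - (α : ℂ)‖ * r, mul_pos (norm_pos_iff.2 h0) hr, ?_⟩
    rw [Multiset.map_cons, Multiset.prod_cons, h]
    conv_lhs => rw [← Complex.norm_mul_exp_arg_mul_I (z - (α : ℂ))]
    simp only [argSum, Multiset.map_cons, Multiset.sum_cons]
    push_cast
    rw [add_mul, Complex.exp_add]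
    ring

/-- As `z` descends to `t`, the argument of `z - α` tends to π if `α` lies to the right of `t` and
to 0 if it lies to the left. -/
lemma tendsto_argSum (s : Multiset ℝ) {t : ℝ} (ht : t ∉ s) :
    Tendsto (fun ε : ℝ => argSum s ⟨t, ε⟩) (𝓝[>] 0)
      (𝓝 (Real.pi * (s.countP (t < ·) : ℕ))) := by
  have hlim : Tendsto (fun ε : ℝ => (⟨t, ε⟩ : ℂ)) (𝓝[>] 0) (𝓝 (t : ℂ)) := by
    have : Continuous fun ε : ℝ => (⟨t, ε⟩ : ℂ) := by
      have h : (fun ε : ℝ => (⟨t, ε⟩ : ℂ)) = fun ε : ℝ => (t : ℂ) + ε * Complex.I := by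
        funext ε; apply Complex.ext <;> simp
      rw [h]; fun_prop
    exact (this.tendsto 0).mono_left nhdsWithin_le_nhds
  induction s using Multiset.induction with
  | empty => simp [argSum]
  | cons α s ih =>
    rw [Multiset.mem_cons, not_or] at ht
    have ih := ih ht.2
    have hα : Tendsto (fun ε : ℝ => ((⟨t, ε⟩ : ℂ) - α).arg) (𝓝[>] 0)
        (𝓝 (Real.pi * ((if t < α then 1 else 0 : ℕ) : ℝ))) := by
      have hsub : Tendsto (fun ε : ℝ => (⟨t, ε⟩ : ℂ) - α) (𝓝[>] 0) (𝓝 ((t : ℂ) - α)) :=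
        hlim.sub_const _
      rcases lt_or_gt_of_ne ht.1 with h | h
      -- `arg` jumps across the negative axis; the approach from above selects the limit π.
      · have h1 := Complex.tendsto_arg_nhdsWithin_im_nonneg_of_re_neg_of_im_zero
          (z := (t : ℂ) - α) (by simpa using h) (by simp)
        rw [if_pos h]
        simp only [Nat.cast_one, mul_one]
        refine h1.comp (tendsto_nhdsWithin_iff.2 ⟨hsub, ?_⟩)
        filter_upwards [self_mem_nhdsWithin] with ε hε
        simpa using le_of_lt hε
      · rw [if_neg h.not_gt]
        have h1 : ((t : ℂ) - α).arg = 0 := by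
          rw [← Complex.ofReal_sub]
          exact Complex.arg_ofReal_of_nonneg (by linarith)
        have h2 : ContinuousAt Complex.arg ((t : ℂ) - α) :=
          Complex.continuousAt_arg (Or.inl (by simpa using h))
        have := h2.tendsto.comp hsub
        simpa [h1, Function.comp_def] using this
    have hsum := hα.add ih
    have e1 : (fun ε : ℝ => argSum (α ::ₘ s) ⟨t, ε⟩) =
        fun ε : ℝ => ((⟨t, ε⟩ : ℂ) - α).arg + argSum s ⟨t, ε⟩ := by
      funext ε; simp [argSum]
    rw [e1]
    convert hsum using 2
    rw [Multiset.countP_cons]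
    push_cast
    ring

lemma splits_of_realRooted {f : ℝ[X]} (hf : RealRooted f) : f.Splits := by
  refine Splits.of_splits_map (algebraMap ℝ ℂ) (IsAlgClosed.splits _) fun z hz => ?_
  have h : aeval z f = 0 := by
    rw [aeval_def, ← eval_map]
    exact isRoot_of_mem_roots hz
  exact ⟨z.re, Complex.ext (by simp) (by simpa using (hf z h).symm)⟩

lemma realRooted_of_aeval_ne_zero {f : ℝ[X]} (h : ∀ z : ℂ, 0 < z.im → aeval z f ≠ 0) :
    RealRooted f := by
  intro z hz
  rcases lt_trichotomy z.im 0 with h1 | h1 | h1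
  · refine absurd ?_ (h (starRingEnd ℂ z) (by simpa using h1))
    rw [Polynomial.aeval_conj, hz, map_zero]
  · exact h1
  · exact absurd hz (h z h1)

lemma aeval_eq_of_splits {f : ℝ[X]} (hf : f.Splits) (z : ℂ) :
    aeval z f = (f.leadingCoeff : ℂ) * (f.roots.map fun α : ℝ => z - (α : ℂ)).prod := by
  conv_lhs => rw [hf.eq_prod_roots]
  rw [map_mul, aeval_C, map_multiset_prod, Multiset.map_map]
  simp

/-- If `g / f` maps the upper half-plane to its closure, the argument of `g / f` stays in
`[0, π]` there. -/
lemma argSum_sub_mem_Icc {f g : ℝ[X]} (hf : RealRooted f) (hg : RealRooted g)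
    (hf0 : 0 < f.leadingCoeff) (hg0 : 0 < g.leadingCoeff)
    (h : ∀ z : ℂ, 0 < z.im →
      0 ≤ (aeval z g).im * (aeval z f).re - (aeval z g).re * (aeval z f).im)
    {z : ℂ} (hz : 0 < z.im) :
    argSum g.roots z - argSum f.roots z ∈ Set.Icc 0 Real.pi := by
  set D : ℂ → ℝ := fun z => argSum g.roots z - argSum f.roots z with hD
  have hDc : ContinuousOn D {z | 0 < z.im} :=
    (continuousOn_argSum _).sub (continuousOn_argSum _)
  -- The hypothesis says Im(g · conj f) ≥ 0, and this imaginary part is a positive multiple of sin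
  -- `D`.
  have hsin : ∀ w : ℂ, 0 < w.im → 0 ≤ Real.sin (D w) := by
    intro w hw
    obtain ⟨r, hr, hrf⟩ := exists_pos_prod_eq_exp_argSum f.roots hw
    obtain ⟨q, hq, hqg⟩ := exists_pos_prod_eq_exp_argSum g.roots hw
    have h1 := h w hw
    rw [aeval_eq_of_splits (splits_of_realRooted hf), aeval_eq_of_splits (splits_of_realRooted hg),
      hrf, hqg] at h1
    simp only [Complex.mul_re, Complex.mul_im, Complex.ofReal_re, Complex.ofReal_im,
      Complex.exp_ofReal_mul_I_re, Complex.exp_ofReal_mul_I_im] at h1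
    have h2 : 0 ≤ (f.leadingCoeff * r * g.leadingCoeff * q) * Real.sin (D w) := by
      refine h1.trans_eq ?_
      rw [hD, Real.sin_sub]
      ring
    exact nonneg_of_mul_nonneg_right h2 (by positivity)
  -- To the right of all roots `D` tends to 0, which fixes the branch. By connectedness, leaving [0,
  -- π] would force a value in (-π, 0) or (π, 2π), where the sine is negative; -π/2 and 3π/2 cap
  -- that value.
  obtain ⟨x, hx⟩ : ∃ x : ℝ, ∀ α ∈ f.roots + g.roots, α < x := by
    obtain ⟨x, hx⟩ := (f.roots + g.roots).toFinset.bddAbove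
    exact ⟨x + 1, fun α hα =>
      (hx (by simpa using hα) : α ≤ x).trans_lt (lt_add_one x)⟩
  have hcount : ∀ p : ℝ[X], (∀ α ∈ p.roots, α < x) →
      Tendsto (fun ε : ℝ => argSum p.roots ⟨x, ε⟩) (𝓝[>] 0) (𝓝 0) := by
    intro p hp
    have := tendsto_argSum p.roots (t := x) fun hm => (hp x hm).false
    rwa [Multiset.countP_eq_zero.2 fun α hα => (hp α hα).not_gt, Nat.cast_zero, mul_zero] at this
  have hlim : Tendsto (fun ε : ℝ => D ⟨x, ε⟩) (𝓝[>] 0) (𝓝 0) := by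
    simpa using (hcount g fun α hα => hx α (Multiset.mem_add.2 (Or.inr hα))).sub
      (hcount f fun α hα => hx α (Multiset.mem_add.2 (Or.inl hα)))
  obtain ⟨ε, hε, hε0⟩ : ∃ ε : ℝ, D ⟨x, ε⟩ ∈ Set.Ioo (-1 : ℝ) 1 ∧ 0 < ε :=
    ((hlim.eventually (Ioo_mem_nhds (by norm_num) (by norm_num))).and
      self_mem_nhdsWithin).exists
  have hmemε : (⟨x, ε⟩ : ℂ) ∈ {z : ℂ | 0 < z.im} := hε0
  have hconn : IsPreconnected {z : ℂ | 0 < z.im} := (convex_halfSpace_im_gt 0).isPreconnected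
  have hpi := Real.pi_gt_three
  constructor
  · by_contra hneg
    rw [not_le] at hneg
    have hv := max_lt hneg (by linarith : -(Real.pi / 2) < 0)
    obtain ⟨w, hw, hwv⟩ := hconn.intermediate_value (show z ∈ {z : ℂ | 0 < z.im} from hz) hmemε hDc
      (show max (D z) (-(Real.pi / 2)) ∈ Set.Icc (D z) (D ⟨x, ε⟩) from
        ⟨le_max_left _ _, max_le (by
          by_contra hlt
          rw [not_le] at hlt
          have := Real.sin_neg_of_neg_of_neg_pi_lt (hlt.trans hneg) (by linarith [hε.1])
          exact absurd (hsin _ hε0) this.not_ge) (by linarith [hε.1])⟩)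
    have := Real.sin_neg_of_neg_of_neg_pi_lt hv
      (lt_of_lt_of_le (by linarith) (le_max_right _ _))
    rw [← hwv] at this
    exact absurd (hsin w hw) this.not_ge
  · by_contra hgt
    rw [not_le] at hgt
    have hv := lt_min hgt (by linarith : Real.pi < 3 * Real.pi / 2)
    obtain ⟨w, hw, hwv⟩ := hconn.intermediate_value hmemε (show z ∈ {z : ℂ | 0 < z.im} from hz) hDc
      (show min (D z) (3 * Real.pi / 2) ∈ Set.Icc (D ⟨x, ε⟩) (D z) from
        ⟨le_min (by linarith [hε.2, hgt]) (by linarith [hε.2]), min_le_left _ _⟩)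
    have h1 : Real.sin (D w - 2 * Real.pi) < 0 := by
      rw [hwv]
      exact Real.sin_neg_of_neg_of_neg_pi_lt
        (by linarith [min_le_right (D z) (3 * Real.pi / 2)]) (by linarith)
    rw [Real.sin_sub_two_pi] at h1
    exact absurd (hsin w hw) h1.not_ge

/-- Boundary limit at `t` of the bound 0 ≤ `D` ≤ π, divided by π. -/
lemma countP_roots_le {f g : ℝ[X]} (hf : RealRooted f) (hg : RealRooted g)
    (hf0 : 0 < f.leadingCoeff) (hg0 : 0 < g.leadingCoeff)
    (h : ∀ z : ℂ, 0 < z.im →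
      0 ≤ (aeval z g).im * (aeval z f).re - (aeval z g).re * (aeval z f).im)
    {t : ℝ} (htf : t ∉ f.roots) (htg : t ∉ g.roots) :
    f.roots.countP (t < ·) ≤ g.roots.countP (t < ·) ∧
      g.roots.countP (t < ·) ≤ f.roots.countP (t < ·) + 1 := by
  have hlim := (tendsto_argSum g.roots htg).sub (tendsto_argSum f.roots htf)
  have hmem := isClosed_Icc.mem_of_tendsto hlim (b := 𝓝[>] (0 : ℝ))
    (s := Set.Icc 0 Real.pi) (by
      filter_upwards [self_mem_nhdsWithin] with ε hε
      exact argSum_sub_mem_Icc hf hg hf0 hg0 h hε)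
  rw [← mul_sub] at hmem
  have hpi := Real.pi_pos
  constructor
  · have := nonneg_of_mul_nonneg_right hmem.1 hpi
    exact_mod_cast sub_nonneg.1 this
  · have h1 : Real.pi * ((g.roots.countP (t < ·) : ℕ) - (f.roots.countP (t < ·) : ℕ) : ℝ)
        ≤ Real.pi * 1 := by simpa using hmem.2
    have h2 := le_of_mul_le_mul_left h1 hpi
    have h3 : ((g.roots.countP (t < ·) : ℕ) : ℝ) ≤ (f.roots.countP (t < ·) : ℕ) + 1 := by
      linarith
    exact_mod_cast h3

lemma lt_countP_of_lt_getElem {l : List ℝ} (hl : l.Pairwise (· ≥ ·)) {i : ℕ} (hi : i < l.length)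
    {t : ℝ} (ht : t < l[i]) : i < l.countP (t < ·) := by
  have h1 : (l.take (i + 1)).countP (t < ·) = (l.take (i + 1)).length := by
    rw [List.countP_eq_length]
    intro a ha
    obtain ⟨k, hk, rfl⟩ := List.getElem_of_mem ha
    rw [List.length_take] at hk
    rw [List.getElem_take]
    have : l[i] ≤ l[k] := by
      rcases (show k ≤ i by omega).eq_or_lt with rfl | h
      · exact le_rfl
      · exact List.pairwise_iff_getElem.1 hl _ _ _ _ h
    simpa using ht.trans_le this
  have h2 := (List.take_sublist (i + 1) l).countP_le (p := (t < ·))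
  rw [h1, List.length_take] at h2
  omega

lemma countP_le_of_getElem_lt {l : List ℝ} (hl : l.Pairwise (· ≥ ·)) {i : ℕ} (hi : i < l.length)
    {t : ℝ} (ht : l[i] < t) : l.countP (t < ·) ≤ i := by
  have h1 : (l.drop i).countP (t < ·) = 0 := by
    rw [List.countP_eq_zero]
    intro a ha
    obtain ⟨k, hk, rfl⟩ := List.getElem_of_mem ha
    rw [List.length_drop] at hk
    rw [List.getElem_drop]
    have : l[i + k] ≤ l[i] := by
      rcases (show i ≤ i + k by omega).eq_or_lt with h | h
      · simp only [← h, le_refl]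
      · exact List.pairwise_iff_getElem.1 hl _ _ _ _ h
    simpa using (this.trans_lt ht).le
  calc l.countP (t < ·) = (l.take i).countP (t < ·) + (l.drop i).countP (t < ·) := by
        rw [← List.countP_append, List.take_append_drop]
    _ ≤ i := by
        rw [h1, add_zero]
        exact List.countP_le_length.trans (by rw [List.length_take]; omega)

/-- The Hermite–Biehler criterion: `f ≪ g` as soon as `g / f` maps the upper half-plane to its
closure. -/
lemma interleaves_of_im_nonneg {f g : ℝ[X]} (hf : RealRooted f) (hg : RealRooted g)
    (hf0 : 0 < f.leadingCoeff) (hg0 : 0 < g.leadingCoeff)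
    (h : ∀ z : ℂ, 0 < z.im →
      0 ≤ (aeval z g).im * (aeval z f).re - (aeval z g).re * (aeval z f).im) :
    Interleaves f g := by
  have hsort : ∀ p : ℝ[X], (rootList p).Pairwise (· ≥ ·) := fun p => Multiset.pairwise_sort _ _
  have hcoe : ∀ p : ℝ[X], ((rootList p : List ℝ) : Multiset ℝ) = p.roots :=
    fun p => Multiset.sort_eq _ _
  have key : ∀ t : ℝ, t ∉ f.roots → t ∉ g.roots →
      (rootList f).countP (t < ·) ≤ (rootList g).countP (t < ·) ∧
      (rootList g).countP (t < ·) ≤ (rootList f).countP (t < ·) + 1 := by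
    intro t h1 h2
    have := countP_roots_le hf hg hf0 hg0 h h1 h2
    rwa [← hcoe f, ← hcoe g, Multiset.coe_countP, Multiset.coe_countP] at this
  -- The counting inequalities hold only off the roots; a violated alternation leaves an open
  -- interval containing such a point.
  have hbetween : ∀ a b : ℝ, a < b → ∃ t, a < t ∧ t < b ∧ t ∉ f.roots ∧ t ∉ g.roots := by
    intro a b hab
    obtain ⟨t, ht, ht'⟩ := (Set.Ioo_infinite hab).exists_notMem_finset (f.roots + g.roots).toFinset
    rw [Multiset.mem_toFinset, Multiset.mem_add, not_or] at ht'
    exact ⟨t, ht.1, ht.2, ht'⟩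
  refine ⟨⟨hf, hf0⟩, ⟨hg, hg0⟩, ?_, fun i hif hig => ?_, fun i hif hig => ?_⟩
  -- To the left of all roots the counts are the full lengths.
  · obtain ⟨x, hx⟩ : ∃ x : ℝ, ∀ α ∈ f.roots + g.roots, x < α := by
      obtain ⟨x, hx⟩ := (f.roots + g.roots).toFinset.bddBelow
      exact ⟨x - 1, fun α hα =>
        (sub_one_lt x).trans_le (hx (by simpa using hα) : x ≤ α)⟩
    have hxf : ∀ α ∈ f.roots, x < α := fun α hα => hx α (Multiset.mem_add.2 (Or.inl hα))
    have hxg : ∀ α ∈ g.roots, x < α := fun α hα => hx α (Multiset.mem_add.2 (Or.inr hα))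
    have hk := key x (fun hm => (hxf x hm).false) (fun hm => (hxg x hm).false)
    have hlen : ∀ p : ℝ[X], (∀ α ∈ p.roots, x < α) →
        (rootList p).countP (x < ·) = (rootList p).length := by
      intro p hp
      rw [List.countP_eq_length]
      intro a ha
      have : a ∈ p.roots := by rw [← hcoe p]; exact ha
      simpa using hp a this
    rw [hlen f hxf, hlen g hxg] at hk
    omega
  · by_contra hlt
    rw [not_le] at hlt
    obtain ⟨t, h1, h2, h3, h4⟩ := hbetween _ _ hlt
    have := (key t h3 h4).1
    have := lt_countP_of_lt_getElem (hsort f) hif h2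
    have := countP_le_of_getElem_lt (hsort g) hig h1
    omega
  · by_contra hlt
    rw [not_le] at hlt
    obtain ⟨t, h1, h2, h3, h4⟩ := hbetween _ _ hlt
    have := (key t h3 h4).2
    have := lt_countP_of_lt_getElem (hsort g) hig h2
    have := countP_le_of_getElem_lt (hsort f) hif h1
    omega

/-- The first sector inequality is the Hermite–Biehler hypothesis. Combinations stay off zero
because all values lie in the sector based at that of `f 0`. -/
theorem interlacing_of_inSector {n : ℕ} {f : Fin (n + 1) → ℝ[X]}
    (hpos : ∀ i, 0 < (f i).leadingCoeff)
    (hne : ∀ z : ℂ, 0 < z.im → ∀ i, aeval z (f i) ≠ 0)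
    (hf : ∀ z : ℂ, 0 < z.im → ∀ i j, i ≤ j → InSector z (aeval z (f i)) (aeval z (f j))) :
    Interlacing f ∧ ∀ c : Fin (n + 1) → ℝ, (∀ j, 0 ≤ c j) → (∃ j, c j ≠ 0) →
      RealRooted (∑ j : Fin (n + 1), C (c j) * f j) := by
  have hreal : ∀ i, RealRooted (f i) := fun i =>
    realRooted_of_aeval_ne_zero fun z hz => hne z hz i
  refine ⟨⟨fun i => ⟨hreal i, hpos i⟩, fun i j hij => interleaves_of_im_nonneg (hreal i) (hreal j)
    (hpos i) (hpos j) fun z hz => (hf z hz i j hij.le).1⟩, fun c hc ⟨j, hj⟩ => ?_⟩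
  refine realRooted_of_aeval_ne_zero fun z hz => ?_
  have := InSector.sum_ne_zero hz (hne z hz 0) (s := Finset.univ)
    (fun i _ => hf z hz 0 i (Fin.zero_le i)) (fun i _ => hne z hz i) (fun i _ => hc i)
    ⟨j, Finset.mem_univ _, hj⟩
  simpa [map_sum] using this

/-! ### Descents of arrangements with a prescribed first letter. -/

/-- The sequences `(a₀, a₁, …, a_n)` starting with `x` whose entries `a₁, …, a_n` are distinct
elements of `T`. -/
noncomputable def arrangements (n : ℕ) (T : Finset ℤ) (x : ℤ) : Finset (Fin (n + 1) → ℤ) :=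
  (Fintype.piFinset fun _ : Fin (n + 1) => insert x T).filter fun a =>
    a 0 = x ∧ (∀ i : Fin n, a i.succ ∈ T) ∧ Function.Injective (Fin.tail a)

lemma mem_arrangements {n : ℕ} {T : Finset ℤ} {x : ℤ} {a : Fin (n + 1) → ℤ} :
    a ∈ arrangements n T x ↔
      a 0 = x ∧ (∀ i : Fin n, a i.succ ∈ T) ∧ Function.Injective (Fin.tail a) := by
  simp only [arrangements, Finset.mem_filter, Fintype.mem_piFinset, Finset.mem_insert,
    and_iff_right_iff_imp]
  rintro ⟨h0, h1, -⟩ i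
  exact Fin.cases (Or.inl h0) (fun i => Or.inr (h1 i)) i

lemma des_succ {s : ℕ} (a : Fin (s + 2) → ℤ) :
    des a = (if a 1 < a 0 then 1 else 0) + des (Fin.tail a) := by
  simp only [des, Finset.card_filter]
  rw [Fin.sum_univ_succ]
  rfl

lemma mem_arrangements_succ {n : ℕ} {T : Finset ℤ} {x c : ℤ} (hc : c ∈ T)
    (a : Fin (n + 2) → ℤ) :
    (a ∈ arrangements (n + 1) T x ∧ a 1 = c) ↔
      a 0 = x ∧ Fin.tail a ∈ arrangements n (T.erase c) c := by
  rw [mem_arrangements, mem_arrangements]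
  have e : Fin.tail a = Fin.cons (a 1) (Fin.tail (Fin.tail a)) := (Fin.cons_self_tail _).symm
  rw [e, Fin.cons_injective_iff]
  simp only [Fin.tail_cons, Fin.cons_zero, Fin.cons_succ, Finset.mem_erase, Set.mem_range,
    not_exists]
  constructor
  · rintro ⟨⟨h0, h1, h2, h3⟩, rfl⟩
    exact ⟨h0, rfl, fun i => ⟨h2 i, h1 i.succ⟩, h3⟩
  · rintro ⟨h0, rfl, h1, h2⟩
    exact ⟨⟨h0, Fin.cases hc fun i => (h1 i).2, fun i => (h1 i).1, h2⟩, rfl⟩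

lemma sum_arrangements_succ (n : ℕ) (T : Finset ℤ) (x : ℤ) :
    ∑ a ∈ arrangements (n + 1) T x, (X : ℝ[X]) ^ des a =
      ∑ c ∈ T, (if c < x then X else 1) *
        ∑ a ∈ arrangements n (T.erase c) c, (X : ℝ[X]) ^ des a := by
  rw [← Finset.sum_fiberwise_of_maps_to (t := T) (g := fun a => a 1)
    (fun a ha => (mem_arrangements.1 ha).2.1 0)]
  refine Finset.sum_congr rfl fun c hc => ?_
  rw [Finset.mul_sum]
  refine Finset.sum_nbij' (fun a => Fin.tail a) (fun a => Fin.cons x a) ?_ ?_ ?_ ?_ ?_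
  · intro a ha
    exact ((mem_arrangements_succ hc a).1 (Finset.mem_filter.1 ha)).2
  · intro a ha
    exact Finset.mem_filter.2 ((mem_arrangements_succ hc _).2 ⟨rfl, by simpa using ha⟩)
  · intro a ha
    have := ((mem_arrangements_succ hc a).1 (Finset.mem_filter.1 ha)).1
    rw [← this, Fin.cons_self_tail]
  · intro a _
    simp
  · intro a ha
    have ha := Finset.mem_filter.1 ha
    have h0 := ((mem_arrangements_succ hc a).1 ha).1
    rw [des_succ, h0, ha.2, pow_add]
    split_ifs <;> simp

/-- The ranks of the elements of `T` run once through 0, …, n - 1. -/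
lemma sum_rank {M : Type*} [AddCommMonoid M] {T : Finset ℤ} {n : ℕ} (hT : T.card = n)
    (f : ℕ → M) :
    ∑ c ∈ T, f (T.filter (· < c)).card = ∑ i ∈ Finset.range n, f i := by
  subst hT
  induction T using Finset.induction_on_max with
  | empty => simp
  | insert m T hm ih =>
    have hmT : m ∉ T := fun h => (hm m h).false
    rw [Finset.sum_insert hmT, Finset.card_insert_of_notMem hmT, Finset.sum_range_succ, ← ih,
      add_comm]
    congr 1
    · refine Finset.sum_congr rfl fun c hc => ?_
      rw [Finset.filter_insert, if_neg (hm c hc).not_gt]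
    · rw [Finset.filter_insert, if_neg (lt_irrefl m), Finset.filter_true_of_mem hm]

lemma lt_iff_rank_lt {T : Finset ℤ} {c x : ℤ} (hc : c ∈ T) :
    c < x ↔ (T.filter (· < c)).card < (T.filter (· < x)).card := by
  constructor
  · intro h
    refine Finset.card_lt_card (Finset.ssubset_iff_of_subset ?_ |>.2 ⟨c, by simp [hc, h], by simp⟩)
    exact Finset.monotone_filter_right _ fun _ _ h' => lt_trans h' h
  · intro h
    by_contra hx
    rw [not_lt] at hx
    exact h.not_ge (Finset.card_le_card
      (Finset.monotone_filter_right _ fun _ _ h' => lt_of_lt_of_le h' hx))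

/-- Only the rank of `x` in `T` matters: comparing the second letter with `x` is comparing ranks,
and erasing `c` from `T` keeps the number of elements below `c`. -/
lemma sum_arrangements {n : ℕ} {T : Finset ℤ} (hT : T.card = n) (x : ℤ) :
    ∑ a ∈ arrangements n T x, (X : ℝ[X]) ^ des a =
      firstLetterPoly n (T.filter (· < x)).card := by
  induction n generalizing T x with
  | zero =>
    have h : arrangements 0 T x = {fun _ => x} := by
      ext a
      rw [mem_arrangements, Finset.mem_singleton]
      constructor
      · rintro ⟨h, -⟩
        funext i
        rw [Fin.eq_zero i, h]
      · rintro rfl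
        exact ⟨rfl, fun i => i.elim0, fun i => i.elim0⟩
    rw [h, Finset.sum_singleton]
    simp [des, firstLetterPoly]
  | succ n ih =>
    rw [sum_arrangements_succ, firstLetterPoly, ← sum_rank hT]
    refine Finset.sum_congr rfl fun c hc => ?_
    rw [ih (by rw [Finset.card_erase_of_mem hc, hT, Nat.add_sub_cancel])]
    have h1 : (T.erase c).filter (· < c) = T.filter (· < c) := by
      rw [Finset.filter_erase, Finset.erase_eq_of_notMem (by simp)]
    rw [h1]
    simp only [lt_iff_rank_lt hc]

/-! ### Signed words with a given set of negative letters. -/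

/-- The sequences `(0, a₁, …, a_n)` such that `|a₁|, …, |a_n|` is a permutation of `1, …, n`. -/
noncomputable def signedWords (n : ℕ) : Finset (Fin (n + 1) → ℤ) :=
  (Fintype.piFinset fun _ : Fin (n + 1) => Finset.Icc (-(n : ℤ)) n).filter fun a =>
    a 0 = 0 ∧ Function.Injective fun i => |a i|

lemma mem_signedWords {n : ℕ} {a : Fin (n + 1) → ℤ} :
    a ∈ signedWords n ↔ (∀ i, |a i| ≤ n) ∧ a 0 = 0 ∧ Function.Injective fun i => |a i| := by
  simp only [signedWords, Finset.mem_filter, Fintype.mem_piFinset, Finset.mem_Icc, abs_le]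

/-- The set `{1, …, n}` with the signs of the elements of `S` changed. -/
noncomputable def flipSigns (n : ℕ) (S : Finset ℤ) : Finset ℤ :=
  (Finset.Icc 1 (n : ℤ)).image fun i => if i ∈ S then -i else i

lemma mem_flipSigns {n : ℕ} {S : Finset ℤ} {c : ℤ} :
    c ∈ flipSigns n S ↔ 1 ≤ |c| ∧ |c| ≤ n ∧ (c < 0 ↔ |c| ∈ S) := by
  simp only [flipSigns, Finset.mem_image, Finset.mem_Icc]
  constructor
  · rintro ⟨i, ⟨h1, h2⟩, rfl⟩
    split_ifs with h
    · rw [abs_neg, abs_of_pos (by omega)]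
      exact ⟨h1, h2, by simp [h]; omega⟩
    · rw [abs_of_pos (by omega)]
      exact ⟨h1, h2, by simp [h]; omega⟩
  · rintro ⟨h1, h2, h3⟩
    refine ⟨|c|, ⟨h1, h2⟩, ?_⟩
    split_ifs with h
    · rw [abs_of_neg (h3.2 h), neg_neg]
    · exact abs_of_nonneg (not_lt.1 fun h' => h (h3.1 h'))

lemma card_flipSigns (n : ℕ) (S : Finset ℤ) : (flipSigns n S).card = n := by
  rw [flipSigns, Finset.card_image_of_injOn, Int.card_Icc]
  · simp
  · intro i hi j hj h
    simp only [Finset.coe_Icc, Set.mem_Icc] at hi hj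
    dsimp only at h
    split_ifs at h <;> omega

lemma card_flipSigns_neg {n : ℕ} {S : Finset ℤ} (hS : S ⊆ Finset.Icc 1 (n : ℤ)) :
    ((flipSigns n S).filter (· < 0)).card = S.card := by
  have : (flipSigns n S).filter (· < 0) = S.image fun i => -i := by
    ext c
    simp only [Finset.mem_filter, mem_flipSigns, Finset.mem_image]
    constructor
    · rintro ⟨⟨-, -, h⟩, hc⟩
      exact ⟨|c|, h.1 hc, by rw [abs_of_neg hc, neg_neg]⟩
    · rintro ⟨i, hi, rfl⟩
      have h := Finset.mem_Icc.1 (hS hi)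
      rw [abs_neg, abs_of_pos (by omega)]
      exact ⟨⟨h.1, h.2, by simp [hi]; omega⟩, by omega⟩
  rw [this, Finset.card_image_of_injective _ neg_injective]

/-- The absolute values of the negative entries of a sequence. -/
noncomputable def negSet {s : ℕ} (a : Fin (s + 1) → ℤ) : Finset ℤ :=
  (Finset.univ.filter fun i : Fin (s + 1) => a i < 0).image fun i => |a i|

lemma card_negSet {n : ℕ} {a : Fin (n + 1) → ℤ} (ha : a ∈ signedWords n) :
    (negSet a).card = neg a :=
  Finset.card_image_of_injective _ (mem_signedWords.1 ha).2.2

lemma negSet_subset {n : ℕ} {a : Fin (n + 1) → ℤ} (ha : a ∈ signedWords n) :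
    negSet a ⊆ Finset.Icc 1 (n : ℤ) := by
  intro c hc
  simp only [negSet, Finset.mem_image, Finset.mem_filter, Finset.mem_univ, true_and] at hc
  obtain ⟨i, hi, rfl⟩ := hc
  exact Finset.mem_Icc.2 ⟨Int.one_le_abs hi.ne, (mem_signedWords.1 ha).1 i⟩

lemma mem_signedWords_negSet {n : ℕ} {S : Finset ℤ} (hS : S ⊆ Finset.Icc 1 (n : ℤ))
    (a : Fin (n + 1) → ℤ) :
    (a ∈ signedWords n ∧ negSet a = S) ↔ a ∈ arrangements n (flipSigns n S) 0 := by
  rw [mem_arrangements]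
  constructor
  · rintro ⟨ha, rfl⟩
    obtain ⟨h1, h2, h3⟩ := mem_signedWords.1 ha
    refine ⟨h2, fun i => mem_flipSigns.2 ⟨?_, h1 _, ?_⟩, ?_⟩
    · refine Int.one_le_abs fun h => (Fin.succ_ne_zero i) (h3 ?_)
      simp [h, h2]
    · simp only [negSet, Finset.mem_image, Finset.mem_filter, Finset.mem_univ, true_and]
      constructor
      · exact fun h => ⟨_, h, rfl⟩
      · rintro ⟨k, hk, hk'⟩
        rwa [← h3 hk']
    · intro i k hik
      have : a i.succ = a k.succ := hik
      exact Fin.succ_injective _ (h3 (by simp only [this]))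
  · rintro ⟨h0, h1, h2⟩
    simp only [mem_flipSigns] at h1
    have hinj : Function.Injective fun i => |a i| := by
      intro i k
      refine Fin.cases ?_ (fun i => ?_) i <;> refine Fin.cases ?_ (fun k => ?_) k
      · exact fun _ => rfl
      · intro h
        have h := (show |a 0| = |a k.succ| from h)
        have := (h1 k).1
        rw [← h, h0] at this
        simp at this
      · intro h
        have h := (show |a i.succ| = |a 0| from h)
        have := (h1 i).1
        rw [h, h0] at this
        simp at this
      · intro h
        have h := (show |a i.succ| = |a k.succ| from h)
        have hs : a i.succ < 0 ↔ a k.succ < 0 := by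
          rw [(h1 i).2.2, (h1 k).2.2, h]
        have : a i.succ = a k.succ := by
          rcases abs_eq_abs.1 h with h' | h'
          · exact h'
          · have := (h1 i).1
            have : a i.succ ≠ 0 := fun h'' => by rw [h''] at this; simp at this
            omega
        rw [h2 this]
    refine ⟨mem_signedWords.2 ⟨Fin.cases (by simp [h0]) fun i => (h1 i).2.1, h0, hinj⟩, ?_⟩
    -- The `n` distinct absolute values exhaust 1, …, n, so each element of `S` really occurs.
    have hmaps : Finset.univ.image (fun i : Fin n => |a i.succ|) = Finset.Icc 1 (n : ℤ) := by
      refine Finset.eq_of_subset_of_card_le ?_ ?_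
      · intro c hc
        obtain ⟨i, -, rfl⟩ := Finset.mem_image.1 hc
        exact Finset.mem_Icc.2 ⟨(h1 i).1, (h1 i).2.1⟩
      · refine (Finset.card_image_of_injective _ (hinj.comp (Fin.succ_injective n))).ge.trans' ?_
        simp
    ext c
    simp only [negSet, Finset.mem_image, Finset.mem_filter, Finset.mem_univ, true_and]
    constructor
    · rintro ⟨i, hi, rfl⟩
      revert hi
      refine Fin.cases (fun hi => ?_) (fun i hi => (h1 i).2.2.1 hi) i
      rw [h0] at hi
      exact absurd hi (lt_irrefl _)
    · intro hc
      obtain ⟨i, -, rfl⟩ := Finset.mem_image.1 (hmaps ▸ hS hc)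
      exact ⟨i.succ, (h1 i).2.2.2 hc, rfl⟩

/-- Each of the `C(n,j)` negative sets contributes the same polynomial. For j > n both sides are
zero. -/
lemma sum_signedWords (n j : ℕ) :
    ∑ a ∈ (signedWords n).filter (fun a => neg a = j), (X : ℝ[X]) ^ des a =
      C ((n.choose j : ℕ) : ℝ) * firstLetterPoly n j := by
  have hmaps : ∀ a ∈ (signedWords n).filter (fun a => neg a = j),
      negSet a ∈ (Finset.Icc 1 (n : ℤ)).powersetCard j := by
    intro a ha
    rw [Finset.mem_filter] at ha
    exact Finset.mem_powersetCard.2 ⟨negSet_subset ha.1, (card_negSet ha.1).trans ha.2⟩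
  rw [← Finset.sum_fiberwise_of_maps_to hmaps]
  have hconst : ∀ S ∈ (Finset.Icc 1 (n : ℤ)).powersetCard j,
      ∑ a ∈ ((signedWords n).filter (fun a => neg a = j)).filter (fun a => negSet a = S),
        (X : ℝ[X]) ^ des a = firstLetterPoly n j := by
    intro S hS
    rw [Finset.mem_powersetCard] at hS
    have : ((signedWords n).filter (fun a => neg a = j)).filter (fun a => negSet a = S) =
        arrangements n (flipSigns n S) 0 := by
      ext a
      rw [← mem_signedWords_negSet hS.1, Finset.mem_filter, Finset.mem_filter]
      constructor
      · exact fun h => ⟨h.1.1, h.2⟩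
      · exact fun h => ⟨⟨h.1, by rw [← card_negSet h.1, h.2, hS.2]⟩, h.2⟩
    rw [this, sum_arrangements (card_flipSigns n S), card_flipSigns_neg hS.1, hS.2]
  rw [Finset.sum_congr rfl hconst, Finset.sum_const, Finset.card_powersetCard, Int.card_Icc]
  simp

/-! ### Type `B` permutations as signed words. -/

lemma word_mem_signedWords {n : ℕ} {σ : Equiv.Perm (Letters n)} (hσ : σ ∈ signedPerms n) :
    word σ ∈ signedWords n := by
  simp only [signedPerms, Finset.mem_filter, Finset.mem_univ, true_and] at hσ
  refine mem_signedWords.2 ⟨fun i => abs_le.2 (Finset.mem_Icc.1 (σ _).2), ?_, fun i k hik => ?_⟩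
  · have := hσ ⟨0, by simp⟩ ⟨0, by simp⟩ (by simp)
    have h : word σ 0 = (σ ⟨0, by simp⟩ : ℤ) := by simp [word]
    omega
  · rcases abs_eq_abs.1 hik with h | h
    · have := congrArg Subtype.val (σ.injective (Subtype.ext h))
      dsimp only at this
      exact Fin.ext (by omega)
    -- Here σ(i) = -σ(k) = σ(-k), so i = -k and both indices are 0.
    · have hk := hσ ⟨(k : ℤ), Finset.mem_Icc.mpr ⟨by omega, by omega⟩⟩
        ⟨-(k : ℤ), Finset.mem_Icc.mpr ⟨by omega, by omega⟩⟩ rfl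
      have := congrArg Subtype.val (σ.injective (Subtype.ext (h.trans hk.symm)))
      dsimp only at this
      exact Fin.ext (by omega)

lemma word_injOn (n : ℕ) : Set.InjOn (word (n := n)) (signedPerms n) := by
  intro σ hσ τ hτ h
  simp only [signedPerms, Finset.coe_filter, Finset.mem_univ, true_and, Set.mem_ofPred_eq] at hσ hτ
  have key : ∀ i : Letters n, 0 ≤ (i : ℤ) → (σ i : ℤ) = τ i := by
    intro i hi
    have hn := (Finset.mem_Icc.1 i.2).2
    have h1 := congrFun h ⟨(i : ℤ).toNat, by omega⟩
    have h2 : ∀ h', (⟨(((i : ℤ).toNat : ℕ) : ℤ), h'⟩ : Letters n) = i :=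
      fun _ => Subtype.ext (Int.toNat_of_nonneg hi)
    simpa only [word, h2] using h1
  refine Equiv.ext fun i => Subtype.ext ?_
  rcases le_total 0 (i : ℤ) with hi | hi
  · exact key i hi
  · have hm := Finset.mem_Icc.1 i.2
    let k : Letters n := ⟨-(i : ℤ), Finset.mem_Icc.2 ⟨by omega, by omega⟩⟩
    have hik : (i : ℤ) = -(k : ℤ) := (neg_neg _).symm
    rw [hσ k i hik, hτ k i hik, key k (by simpa [k] using hi)]

lemma word_surjOn (n : ℕ) : Set.SurjOn (word (n := n)) (signedPerms n) (signedWords n) := by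
  intro a ha
  obtain ⟨h1, h0, hinj⟩ := mem_signedWords.1 ha
  have hlt : ∀ x : Letters n, (x : ℤ).natAbs < n + 1 := fun x => by
    have := Finset.mem_Icc.1 x.2
    omega
  -- The odd extension of `a` to negative arguments.
  let v : Letters n → ℤ := fun x => (x : ℤ).sign * a ⟨(x : ℤ).natAbs, hlt x⟩
  have habs : ∀ x, |v x| = |a ⟨(x : ℤ).natAbs, hlt x⟩| := by
    intro x
    rcases lt_trichotomy (x : ℤ) 0 with hx | hx | hx
    · simp only [v, Int.sign_eq_neg_one_of_neg hx, neg_mul, one_mul, abs_neg]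
    · have : (⟨(x : ℤ).natAbs, hlt x⟩ : Fin (n + 1)) = 0 := Fin.ext (by simp [hx])
      simp only [v, this, h0, mul_zero]
    · simp only [v, Int.sign_eq_one_of_pos hx, one_mul]
  have hneg : ∀ x y : Letters n, (y : ℤ) = -(x : ℤ) → v y = -v x := by
    intro x y hxy
    simp only [v, hxy, Int.sign_neg, Int.natAbs_neg, neg_mul]
  let f : Letters n → Letters n := fun x =>
    ⟨v x, Finset.mem_Icc.2 (abs_le.1 ((habs x).trans_le (h1 _)))⟩
  have hf : Function.Injective f := by
    intro x y hxy
    have hv : v x = v y := congrArg Subtype.val hxy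
    have hxy' : (x : ℤ).natAbs = (y : ℤ).natAbs := by
      have := congrArg (|·|) hv
      simp only [habs] at this
      exact congrArg Fin.val (hinj this)
    rcases Int.natAbs_eq_natAbs_iff.1 hxy' with h | h
    · exact Subtype.ext h
    · have h2 := hneg y x h
      have h3 : |v y| = 0 := by rw [abs_eq_zero]; omega
      rw [habs] at h3
      have h4 := congrArg Fin.val (hinj (h3.trans (by rw [h0, abs_zero] : (0 : ℤ) = |a 0|)))
      refine Subtype.ext ?_
      simp only [Fin.val_zero] at h4
      omega
  let σ : Equiv.Perm (Letters n) := Equiv.ofBijective f (Finite.injective_iff_bijective.1 hf)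
  refine ⟨σ, ?_, ?_⟩
  · simp only [signedPerms, Finset.coe_filter, Finset.mem_univ, true_and, Set.mem_ofPred_eq]
    exact hneg
  · funext i
    refine Fin.cases ?_ (fun i => ?_) i
    · rw [h0]
      change v _ = 0
      simp [v]
    · change v _ = a i.succ
      simp only [v]
      rw [Int.sign_eq_one_of_pos (by simp), one_mul]
      rfl

lemma B_eq_card_signedWords (n k j : ℕ) :
    B n k j = ((signedWords n).filter fun a => des a = k ∧ neg a = j).card := by
  refine Finset.card_nbij word ?_ ?_ ?_
  · intro σ hσ
    have h := Finset.mem_filter.1 hσ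
    exact Finset.mem_filter.2 ⟨word_mem_signedWords h.1, h.2⟩
  · exact (word_injOn n).mono fun σ hσ => (Finset.mem_filter.1 hσ).1
  · intro a ha
    have h := Finset.mem_filter.1 ha
    obtain ⟨σ, hσ, rfl⟩ := word_surjOn n h.1
    exact ⟨σ, Finset.mem_filter.2 ⟨hσ, h.2⟩, rfl⟩

/-! ### Identification of the polynomials and conclusion. -/

lemma des_le {s : ℕ} (a : Fin (s + 1) → ℤ) : des a ≤ s :=
  (Finset.card_filter_le _ _).trans (by simp)

lemma bigP_eq (n j : ℕ) :
    bigP n j = C ((n.choose j : ℕ) : ℝ) * firstLetterPoly n j := by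
  rw [← sum_signedWords, bigP, ← Finset.sum_fiberwise_of_maps_to (t := Finset.range (n + 1))
    (g := fun a => des a) fun a _ => Finset.mem_range.2 (Nat.lt_succ_of_le (des_le a))]
  refine Finset.sum_congr rfl fun k _ => ?_
  rw [Finset.sum_congr rfl fun a ha => by rw [(Finset.mem_filter.1 ha).2], Finset.sum_const,
    Finset.filter_filter, B_eq_card_signedWords, nsmul_eq_mul, map_natCast]
  simp only [and_comm]

lemma bigP_eq_choose_mul_smallP {n j : ℕ} (hj : j ≤ n) :
    bigP n j = C ((n.choose j : ℕ) : ℝ) * smallP n j := by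
  have : ((n.choose j : ℕ) : ℝ) ≠ 0 := Nat.cast_ne_zero.2 (Nat.choose_pos hj).ne'
  rw [bigP, smallP, Finset.mul_sum]
  refine Finset.sum_congr rfl fun k _ => ?_
  rw [← mul_assoc, ← C_mul, b, mul_div_cancel₀ _ this]

lemma smallP_eq {n j : ℕ} (hj : j ≤ n) : smallP n j = firstLetterPoly n j := by
  have : (C ((n.choose j : ℕ) : ℝ)) ≠ 0 :=
    C_ne_zero.2 (Nat.cast_ne_zero.2 (Nat.choose_pos hj).ne')
  exact mul_left_cancel₀ this ((bigP_eq_choose_mul_smallP hj).symm.trans (bigP_eq n j))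

lemma leadingCoeff_firstLetterPoly_pos {n j : ℕ} (hj : j ≤ n) :
    0 < (firstLetterPoly n j).leadingCoeff := by
  -- Nonvanishing at the point `I` rules out the zero polynomial; the sign comes from the
  -- coefficients, which are quotients of counts.
  have hne : firstLetterPoly n j ≠ 0 := fun h =>
    (firstLetterPoly_inSector (z := Complex.I) (by simp) n).2 j hj (by rw [h, map_zero])
  refine lt_of_le_of_ne ?_ (leadingCoeff_ne_zero.2 hne).symm
  rw [← smallP_eq hj, leadingCoeff, smallP, finsetSum_coeff]
  refine Finset.sum_nonneg fun k _ => ?_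
  rw [coeff_C_mul, coeff_X_pow]
  refine mul_nonneg (div_nonneg (Nat.cast_nonneg _) (Nat.cast_nonneg _)) ?_
  split_ifs
  exacts [zero_le_one, le_rfl]

/-- Positive weights preserve the sector relation. Weights 1 give the `p_{n,j}`, binomial weights
the `P_{n,j}`. -/
theorem interlacing_mul_firstLetterPoly (n : ℕ) {w : Fin (n + 1) → ℝ} (hw : ∀ j, 0 < w j) :
    Interlacing (fun j : Fin (n + 1) => C (w j) * firstLetterPoly n j) ∧
      ∀ c : Fin (n + 1) → ℝ, (∀ j, 0 ≤ c j) → (∃ j, c j ≠ 0) →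
        RealRooted (∑ j : Fin (n + 1), C (c j) * (C (w j) * firstLetterPoly n j)) := by
  refine interlacing_of_inSector (f := fun j : Fin (n + 1) => C (w j) * firstLetterPoly n j)
    (fun i => ?_) (fun z hz i => ?_) fun z hz i j hij => ?_
  · rw [leadingCoeff_mul, leadingCoeff_C]
    exact mul_pos (hw i) (leadingCoeff_firstLetterPoly_pos (Nat.le_of_lt_succ i.2))
  · rw [map_mul, aeval_C]
    exact mul_ne_zero (by simpa using (hw i).ne')
      ((firstLetterPoly_inSector hz n).2 i (Nat.le_of_lt_succ i.2))
  · rw [map_mul, map_mul, aeval_C, aeval_C]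
    exact ((firstLetterPoly_inSector hz n).1 i j hij (Nat.le_of_lt_succ j.2)).smul
      (hw i).le (hw j).le

end SignedDescents

theorem mainTheorem6 (n : ℕ) (hn : 1 ≤ n) :
    (SignedDescents.Interlacing (fun j : Fin (n + 1) => SignedDescents.smallP n j) ∧
      ∀ c : Fin (n + 1) → ℝ, (∀ j, 0 ≤ c j) → (∃ j, c j ≠ 0) →
        SignedDescents.RealRooted
          (∑ j : Fin (n + 1), Polynomial.C (c j) * SignedDescents.smallP n j)) ∧
    (∀ j : Fin (n + 1), SignedDescents.bigP n j =
      Polynomial.C ((n.choose j : ℕ) : ℝ) * SignedDescents.smallP n j) ∧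
    (SignedDescents.Interlacing (fun j : Fin (n + 1) => SignedDescents.bigP n j) ∧
      ∀ c : Fin (n + 1) → ℝ, (∀ j, 0 ≤ c j) → (∃ j, c j ≠ 0) →
        SignedDescents.RealRooted
          (∑ j : Fin (n + 1), Polynomial.C (c j) * SignedDescents.bigP n j)) := by
  have hj : ∀ j : Fin (n + 1), (j : ℕ) ≤ n := fun j => Nat.le_of_lt_succ j.2
  have hs : ∀ j : Fin (n + 1), SignedDescents.smallP n j =
      Polynomial.C 1 * SignedDescents.firstLetterPoly n j := fun j => by
    rw [SignedDescents.smallP_eq (hj j), map_one, one_mul]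
  simp only [hs, SignedDescents.bigP_eq]
  refine ⟨SignedDescents.interlacing_mul_firstLetterPoly n fun _ => one_pos, fun j => ?_,
    SignedDescents.interlacing_mul_firstLetterPoly n fun j =>
      Nat.cast_pos.2 (Nat.choose_pos (hj j))⟩
  rw [map_one, one_mul]
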